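/- Consider four bodies with masses $m_1,m_2,m_3,m_4>0$ at pairwise distinct points $q_1,q_2,q_3,q_4$ of the Euclidean plane $\mathbb{R}^2$, and put $r_{ij}=\|q_i-q_j\|$. Suppose that they form a central configuration of the Newtonian four-body problem, that is, for some $\lambda\in\mathbb{R}$, $$\lambda\, m_i\,(q_i-q_{CM})=\sum_{j\ne i}\frac{m_i m_j\,(q_j-q_i)}{r_{ij}^3},\qquad i=1,2,3,4,$$ where $q_{CM}=\frac{1}{m_1+m_2+m_3+m_4}\sum_{i} m_i q_i$. Suppose also that no three of the points are collinear, and that the configuration is either concave (one of the points lies strictly inside the convex hull of the other three) or standard convex (no point lies in the convex hull of the other three, and the points are numbered consecutively along the boundary of the convex quadrilateral that they form, so that its diagonals are $q_1q_3$ and $q_2q_4$). If the four points lie on a common circle, $m_1=m_2$ and $m_3=m_4$, then the configuration is an isosceles trapezoid with bases $q_1q_2$ and $q_3q_4$. That is, $q_1q_2q_3q_4$ is a convex quadrilateral whose vertices are in this order, the lines $q_1q_2$ and $q_3q_4$ are parallel, $r_{14}=r_{23}$, and $r_{13}=r_{24}$ (a square counts as an isosceles trapezoid). -/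

import Mathlib

open scoped Affine

/-- The Euclidean plane. -/
abbrev Plane : Type := EuclideanSpace ℝ (Fin 2)

/-- A configuration of four bodies in the plane; the bodies `1, 2, 3, 4` have the indices
`0, 1, 2, 3`. -/
abbrev PlanarConfig : Type := Fin 4 → Plane

/-- `q` is a central configuration of the Newtonian four-body problem with masses `m`:
the bodies are at distinct positions and, for some real `lam` and every `i`,
`lam * m i * (q i - q_CM) = ∑_{j ≠ i} m i * m j * (q j - q i) / r_ij ^ 3`,
where `q_CM` is the center of mass. -/
def IsCentralConfiguration (m : Fin 4 → ℝ) (q : PlanarConfig) : Prop :=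
  Function.Injective q ∧
    ∃ lam : ℝ, ∀ i : Fin 4,
      (lam * m i) • (q i - Finset.univ.centerMass m q) =
        ∑ j ∈ Finset.univ.erase i, (m i * m j / dist (q i) (q j) ^ 3) • (q j - q i)

/-- No two of the points coincide and no three of them are on a line. -/
def IsNondegenerate (q : PlanarConfig) : Prop :=
  Function.Injective q ∧
    ∀ i j k : Fin 4, i ≠ j → i ≠ k → j ≠ k → ¬ Collinear ℝ {q i, q j, q k}

/-- Non-degenerate, and one point lies strictly inside the convex hull of the other three. -/
def IsConcaveConfiguration (q : PlanarConfig) : Prop :=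
  IsNondegenerate q ∧ ∃ i : Fin 4, q i ∈ interior (convexHull ℝ (q '' {j | j ≠ i}))

/-- Non-degenerate, and no point lies in the convex hull of the other three. -/
def IsConvexConfiguration (q : PlanarConfig) : Prop :=
  IsNondegenerate q ∧ ∀ i : Fin 4, q i ∉ convexHull ℝ (q '' {j | j ≠ i})

/-- A convex configuration whose points are numbered consecutively along the boundary of
the quadrilateral: the segments `P₁P₃` and `P₂P₄` are the diagonals, that is, the two joining
segments that cross each other, and the other four joining segments are the sides. -/
def IsStandardConvexConfiguration (q : PlanarConfig) : Prop :=
  IsConvexConfiguration q ∧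
    (openSegment ℝ (q 0) (q 2) ∩ openSegment ℝ (q 1) (q 3)).Nonempty

/-- `P₁P₂P₃P₄` is an isosceles trapezoid with bases `P₁P₂` and `P₃P₄`: a convex quadrilateral
(vertices in this order) with parallel bases, legs of equal length and diagonals of equal length.
Squares are included; the condition on the diagonals rules out other parallelograms
than rectangles. -/
def IsIsoscelesTrapezoid (q : PlanarConfig) : Prop :=
  IsStandardConvexConfiguration q ∧
    line[ℝ, q 0, q 1] ∥ line[ℝ, q 2, q 3] ∧
    dist (q 0) (q 3) = dist (q 1) (q 2) ∧
    dist (q 0) (q 2) = dist (q 1) (q 3)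

/-!
A point of a circle is never interior to the convex hull of other points of it, so the
configuration is convex. Put `S_ij = r_ij⁻³ - μ` with `μ = -lam / ∑ m_j`; the equations of a
central configuration become `∑_j m_j S_ij (q_j - q_i) = 0`.

For `i = 1` the equality `m_3 = m_4` leaves a relation
`k (q_2 - q_1) + S_13 (q_3 - q_1) + S_14 (q_4 - q_1) = 0`, and comparison with the crossing point
of the diagonals, together with the similarity of the triangles they cut off, turns it into
`S_13 r_13 r_23 + S_14 r_14 r_24 = 0`. In particular `S_13` and `S_14` are not both positive, so
`μ > 0`. Eliminating between two relations of this kind gives `S_13 r_13² = S_24 r_24²`, and another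
pair gives `S_14 r_14² = S_23 r_23²`. For `μ > 0` the function `(r⁻³ - μ) r² = r⁻¹ - μ r²` is
strictly decreasing, so both diagonals and both legs are equal, which forces parallel bases.
-/

open EuclideanGeometry AffineMap
open scoped RealInnerProductSpace

theorem notMem_interior_convexHull_of_cospherical {E : Type*} [NormedAddCommGroup E]
    [NormedSpace ℝ E] [Nontrivial E] {s : Set E} (hs : Cospherical s) {x : E} (hx : x ∈ s) :
    x ∉ interior (convexHull ℝ s) := by
  obtain ⟨o, R, hR⟩ := hs
  have hball : convexHull ℝ s ⊆ Metric.closedBall o R :=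
    convexHull_min (fun y hy => (hR y hy).le) (convex_closedBall o R)
  intro hint
  have hlt := interior_mono hball hint
  rw [interior_closedBall', Metric.mem_ball, hR x hx] at hlt
  exact lt_irrefl R hlt

section Crossing

variable {k V P : Type*} [Field k] [AddCommGroup V] [Module k V] [AddTorsor V P]
  {a b c d : P} {s t : k}

theorem smul_vsub_eq_of_lineMap_eq (hcross : lineMap a c s = lineMap b d t) :
    s • (c -ᵥ a) = t • (d -ᵥ a) + (1 - t) • (b -ᵥ a) := by
  have h : s • (c -ᵥ a) = t • (d -ᵥ b) + (b -ᵥ a) := by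
    simpa only [lineMap_apply, vadd_vsub, vadd_vsub_assoc] using congrArg (· -ᵥ a) hcross
  rw [h, ← vsub_sub_vsub_cancel_right d b a]
  module

theorem mul_add_mul_eq_zero_of_lineMap_eq {x y z : k} (habd : ¬ Collinear k {a, b, d})
    (hcross : lineMap a c s = lineMap b d t)
    (hsum : x • (b -ᵥ a) + y • (c -ᵥ a) + z • (d -ᵥ a) = 0) : y * t + z * s = 0 := by
  have hdep : (y * t + z * s) • (d -ᵥ a) = -(x * s + y * (1 - t)) • (b -ᵥ a) := by
    linear_combination (norm := module) s • hsum - y • smul_vsub_eq_of_lineMap_eq hcross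
  by_contra hne
  refine habd ((collinear_iff_of_mem (p₀ := a) (by simp)).2 ⟨b -ᵥ a, ?_⟩)
  have hd : d = (-(x * s + y * (1 - t)) / (y * t + z * s)) • (b -ᵥ a) +ᵥ a := by
    rw [eq_vadd_iff_vsub_eq, div_eq_inv_mul, mul_smul, ← hdep, inv_smul_smul₀ hne]
  simp only [Set.mem_insert_iff, Set.mem_singleton_iff, forall_eq_or_imp, forall_eq]
  exact ⟨⟨0, by simp⟩, ⟨1, by simp⟩, _, hd⟩

end Crossing

section Geometry

variable {V P : Type*} [NormedAddCommGroup V] [InnerProductSpace ℝ V] [MetricSpace P]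
  [NormedAddTorsor V P]

theorem dist_mul_dist_eq_of_cospherical_of_sbtw {a b c d p : P} (h : Cospherical {a, b, c, d})
    (hac : Sbtw ℝ a p c) (hbd : Sbtw ℝ b p d) :
    dist b p * dist a d = dist a p * dist b c := by
  have hchords : dist a p * dist c p = dist b p * dist d p :=
    mul_dist_eq_mul_dist_of_cospherical_of_angle_eq_pi
      (by rwa [Set.insert_comm c b]) hac.angle₁₂₃_eq_pi hbd.angle₁₂₃_eq_pi
  have hangle : ∠ b p c = ∠ a p d := by
    rw [angle_eq_angle_of_angle_eq_pi_of_angle_eq_pi hbd.angle₁₂₃_eq_pi hac.angle₃₂₁_eq_pi,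
      angle_comm]
  have hap : dist a p ≠ 0 := dist_ne_zero.2 hac.left_ne
  have hsimilar := dist_mul_of_eq_angle_of_dist_mul a p d b p c (dist b p / dist a p) hangle
    (by field_simp) (by field_simp; linarith)
  rw [hsimilar]
  field_simp

theorem mul_dist_add_mul_dist_eq_zero_of_cospherical {a b c d p : P} {x y z : ℝ}
    (h : Cospherical {a, b, c, d}) (hac : Sbtw ℝ a p c) (hbd : Sbtw ℝ b p d)
    (hab : a ≠ b) (had : a ≠ d)
    (hsum : x • (b -ᵥ a) + y • (c -ᵥ a) + z • (d -ᵥ a) = 0) :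
    y * dist a c * dist b c + z * dist a d * dist b d = 0 := by
  obtain ⟨⟨s, ⟨hs, -⟩, hsp⟩, -⟩ := sbtw_iff_mem_image_Ioo_and_ne.1 hac
  obtain ⟨⟨t, ⟨ht, -⟩, htp⟩, -⟩ := sbtw_iff_mem_image_Ioo_and_ne.1 hbd
  have hap : dist a p = s * dist a c := by
    rw [← hsp, dist_left_lineMap, Real.norm_of_nonneg hs.le]
  have hbp : dist b p = t * dist b d := by
    rw [← htp, dist_left_lineMap, Real.norm_of_nonneg ht.le]
  have habd : ¬ Collinear ℝ {a, b, d} := by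
    rw [← affineIndependent_iff_not_collinear_set]
    exact (h.subset (by simp [Set.insert_subset_iff])).affineIndependent_of_ne hab had
      hbd.left_ne_right
  have hyz : y * t + z * s = 0 :=
    mul_add_mul_eq_zero_of_lineMap_eq habd (hsp.trans htp.symm) hsum
  have hsimilar := dist_mul_dist_eq_of_cospherical_of_sbtw h hac hbd
  rw [hap, hbp] at hsimilar
  refine (mul_eq_zero.1 ?_).resolve_left hs.ne'
  linear_combination dist a d * dist b d * hyz - y * hsimilar

theorem smul_sub_eq_smul_of_norm_eq {x y z : V} {s t : ℝ} (hleg : ‖z‖ = ‖y - x‖)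
    (hdiag : ‖y‖ = ‖z - x‖) (hcross : s • y = t • z + (1 - t) • x) :
    (s + t) • (y - z) = (2 - s - t) • x := by
  have hleg_sq := congrArg (· ^ 2) hleg
  have hdiag_sq := congrArg (· ^ 2) hdiag
  simp only [norm_sub_sq_real] at hleg_sq hdiag_sq
  -- `y + z - x` is twice the vector from the midpoint of `0`, `x` to the midpoint of `y`, `z`.
  have horth_left : ⟪y + z - x, x⟫ = 0 := by
    rw [inner_sub_left, inner_add_left, real_inner_self_eq_norm_sq]
    linarith
  have horth_right : ⟪y + z - x, y - z⟫ = 0 := by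
    simp only [inner_sub_left, inner_add_left, inner_sub_right, real_inner_self_eq_norm_sq]
    rw [real_inner_comm z y, real_inner_comm y x, real_inner_comm z x]
    linarith
  have hsplit : (s + t) • (y - z) - (2 - s - t) • x = (t - s) • (y + z - x) := by
    linear_combination (norm := module) (2 : ℝ) • hcross
  have hsq : (t - s) * ⟪y + z - x, y + z - x⟫ = 0 := by
    rw [← inner_smul_right, ← hsplit, inner_sub_right, inner_smul_right, inner_smul_right,
      horth_left, horth_right]
    ring
  rw [mul_eq_zero, inner_self_eq_zero, ← smul_eq_zero] at hsq
  exact sub_eq_zero.1 (hsplit.trans hsq)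

theorem parallel_of_sbtw_of_dist_eq {a b c d p : P} (hac : Sbtw ℝ a p c) (hbd : Sbtw ℝ b p d)
    (hleg : dist a d = dist b c) (hdiag : dist a c = dist b d) :
    line[ℝ, a, b] ∥ line[ℝ, c, d] := by
  obtain ⟨⟨s, hs, hsp⟩, -⟩ := sbtw_iff_mem_image_Ioo_and_ne.1 hac
  obtain ⟨⟨t, ht, htp⟩, -⟩ := sbtw_iff_mem_image_Ioo_and_ne.1 hbd
  have hratio : (s + t) • (c -ᵥ d) = (2 - s - t) • (b -ᵥ a) := by
    rw [← vsub_sub_vsub_cancel_right c d a]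
    refine smul_sub_eq_smul_of_norm_eq ?_ ?_ (smul_vsub_eq_of_lineMap_eq (hsp.trans htp.symm))
    · simpa only [vsub_sub_vsub_cancel_right, ← dist_eq_norm_vsub, dist_comm] using hleg
    · simpa only [vsub_sub_vsub_cancel_right, ← dist_eq_norm_vsub, dist_comm] using hdiag
  have hst : s + t ≠ 0 := (add_pos hs.1 ht.1).ne'
  have hst' : 2 - s - t ≠ 0 := by linarith [hs.2, ht.2]
  rw [AffineSubspace.affineSpan_pair_parallel_iff_vectorSpan_eq, vectorSpan_pair_rev,
    vectorSpan_pair, ← Submodule.span_singleton_smul_eq (IsUnit.mk0 _ hst'), ← hratio,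
    Submodule.span_singleton_smul_eq (IsUnit.mk0 _ hst)]

end Geometry

/-- Newton's coefficient `r⁻³` shifted by a constant `μ`. For `μ = -lam / ∑ i, m i` the shift
absorbs the left-hand side of the equations of a central configuration: the `i`-th equation becomes
`∑ j, m j * reducedAttraction μ r_ij * (q j - q i) = 0`. -/
noncomputable def reducedAttraction (μ r : ℝ) : ℝ := (r ^ 3)⁻¹ - μ

theorem pos_of_reducedAttraction_mul_add_eq_zero {μ x y u v : ℝ} (hx : 0 < x) (hy : 0 < y)
    (hu : 0 < u) (hv : 0 < v)
    (h : reducedAttraction μ x * u + reducedAttraction μ y * v = 0) : 0 < μ := by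
  by_contra! hμ
  have hpos : ∀ {r : ℝ}, 0 < r → 0 < reducedAttraction μ r := fun hr =>
    sub_pos.2 (hμ.trans_lt (by positivity))
  have hx' := hpos hx
  have hy' := hpos hy
  exact (by positivity : 0 < reducedAttraction μ x * u + reducedAttraction μ y * v).ne' h

theorem strictAntiOn_reducedAttraction_mul_sq {μ : ℝ} (hμ : 0 < μ) :
    StrictAntiOn (fun r => reducedAttraction μ r * r ^ 2) (Set.Ioi 0) := by
  have hexpand : ∀ {r : ℝ}, 0 < r →
      reducedAttraction μ r * r ^ 2 = r⁻¹ - μ * r ^ 2 := fun hr => by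
    rw [reducedAttraction]
    field_simp
  intro x (hx : 0 < x) y (hy : 0 < y) hxy
  simp only [hexpand hx, hexpand hy]
  gcongr

theorem eq_of_reducedAttraction_mul_add_eq_zero {μ x y u v : ℝ} (hx : 0 < x) (hy : 0 < y)
    (hu : 0 < u) (hv : 0 < v)
    (h : reducedAttraction μ x * x * v + reducedAttraction μ u * u * y = 0)
    (h' : reducedAttraction μ y * y * v + reducedAttraction μ u * u * x = 0) : x = y := by
  have hμ : 0 < μ := by
    rw [mul_assoc, mul_assoc] at h
    exact pos_of_reducedAttraction_mul_add_eq_zero hx hu (mul_pos hx hv) (mul_pos hu hy) h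
  refine (strictAntiOn_reducedAttraction_mul_sq hμ).injOn hx hy (mul_right_cancel₀ hv.ne' ?_)
  linear_combination x * h - y * h'

theorem IsCentralConfiguration.exists_sum_reducedAttraction_smul_eq_zero {m : Fin 4 → ℝ}
    {q : PlanarConfig} (hcc : IsCentralConfiguration m q) (hm : ∀ i, m i ≠ 0)
    (hM : ∑ i, m i ≠ 0) :
    ∃ μ : ℝ, ∀ i, ∑ j, (m j * reducedAttraction μ (dist (q i) (q j))) • (q j - q i) = 0 := by
  obtain ⟨-, lam, h⟩ := hcc
  refine ⟨-lam / ∑ j, m j, fun i => ?_⟩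
  have hforce : ∑ j, (m j * (dist (q i) (q j) ^ 3)⁻¹) • (q j - q i) =
      lam • (q i - Finset.univ.centerMass m q) := by
    refine smul_right_injective _ (hm i) ?_
    simp only [Finset.smul_sum, smul_smul, ← div_eq_mul_inv, ← mul_div_assoc]
    rw [mul_comm (m i) lam, h i, Finset.sum_erase _ (by simp)]
  have hcenter : ∑ j, m j • (q j - q i) =
      (∑ j, m j) • (Finset.univ.centerMass m q - q i) := by
    simp only [smul_sub, Finset.sum_sub_distrib, ← Finset.sum_smul, Finset.centerMass,
      smul_inv_smul₀ hM]
  calc ∑ j, (m j * reducedAttraction (-lam / ∑ j, m j) (dist (q i) (q j))) • (q j - q i)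
      = ∑ j, (m j * (dist (q i) (q j) ^ 3)⁻¹) • (q j - q i) +
          (lam / ∑ j, m j) • ∑ j, m j • (q j - q i) := by
        rw [Finset.smul_sum, ← Finset.sum_add_distrib]
        refine Finset.sum_congr rfl fun j _ => ?_
        rw [reducedAttraction]
        module
    _ = 0 := by
        rw [hforce, hcenter, smul_smul, div_mul_cancel₀ _ hM]
        module

theorem reducedAttraction_mul_dist_add_eq_zero {V : Type*} [NormedAddCommGroup V]
    [InnerProductSpace ℝ V] {m : Fin 4 → ℝ} {q : Fin 4 → V} {μ : ℝ} {p : V} {i j k l : Fin 4}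
    (hnodup : [i, j, k, l].Nodup) (hq : Function.Injective q)
    (hcirc : Cospherical (Set.range q)) (hik : Sbtw ℝ (q i) p (q k)) (hjl : Sbtw ℝ (q j) p (q l))
    (hmass : m k = m l) (hl : m l ≠ 0)
    (hsum : ∑ n, (m n * reducedAttraction μ (dist (q i) (q n))) • (q n - q i) = 0) :
    reducedAttraction μ (dist (q i) (q k)) * dist (q i) (q k) * dist (q j) (q k) +
      reducedAttraction μ (dist (q i) (q l)) * dist (q i) (q l) * dist (q j) (q l) = 0 := by
  have huniv : Finset.univ = {i, j, k, l} := by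
    clear * - hnodup
    decide +revert
  obtain ⟨⟨ne_ij, ne_ik, ne_il⟩, ⟨ne_jk, ne_jl⟩, ne_kl⟩ :
      (i ≠ j ∧ i ≠ k ∧ i ≠ l) ∧ (j ≠ k ∧ j ≠ l) ∧ k ≠ l := by
    simpa using hnodup
  rw [huniv, Finset.sum_insert (by simp [ne_ij, ne_ik, ne_il]),
    Finset.sum_insert (by simp [ne_jk, ne_jl]), Finset.sum_pair ne_kl, sub_self, smul_zero,
    zero_add, hmass, ← add_assoc] at hsum
  have hbalance := mul_dist_add_mul_dist_eq_zero_of_cospherical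
    (hcirc.subset (by simp [Set.insert_subset_iff])) hik hjl (hq.ne ne_ij) (hq.ne ne_il) hsum
  refine mul_left_cancel₀ hl ?_
  linear_combination hbalance

theorem not_isConcaveConfiguration_of_cospherical {q : PlanarConfig}
    (hcirc : Cospherical (Set.range q)) : ¬ IsConcaveConfiguration q := fun ⟨_, i, hi⟩ =>
  notMem_interior_convexHull_of_cospherical hcirc (Set.mem_range_self i)
    (interior_mono (convexHull_mono (Set.image_subset_range q _)) hi)

theorem IsStandardConvexConfiguration.exists_sbtw_diagonals {q : PlanarConfig}
    (hstd : IsStandardConvexConfiguration q) :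
    ∃ p, Sbtw ℝ (q 0) p (q 2) ∧ Sbtw ℝ (q 1) p (q 3) := by
  obtain ⟨⟨⟨hq, -⟩, -⟩, p, hp02, hp13⟩ := hstd
  rw [openSegment_eq_image_lineMap] at hp02 hp13
  exact ⟨p, sbtw_iff_mem_image_Ioo_and_ne.2 ⟨hp02, hq.ne (by decide)⟩,
    sbtw_iff_mem_image_Ioo_and_ne.2 ⟨hp13, hq.ne (by decide)⟩⟩

theorem mainTheorem3_general (m : Fin 4 → ℝ) (q : PlanarConfig)
    (hm : ∀ i, m i ≠ 0) (hM : ∑ i, m i ≠ 0)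
    (hcc : IsCentralConfiguration m q)
    (hshape : IsConcaveConfiguration q ∨ IsStandardConvexConfiguration q)
    (hcirc : EuclideanGeometry.Concyclic (Set.range q))
    (h12 : m 0 = m 1) (h34 : m 2 = m 3) :
    IsIsoscelesTrapezoid q := by
  have hstd := hshape.resolve_left (not_isConcaveConfiguration_of_cospherical hcirc.1)
  have hdist : ∀ i j, i ≠ j → 0 < dist (q i) (q j) := fun i j hij => dist_pos.2 (hcc.1.ne hij)
  obtain ⟨p, hp02, hp13⟩ := hstd.exists_sbtw_diagonals
  obtain ⟨μ, hμ⟩ := hcc.exists_sum_reducedAttraction_smul_eq_zero hm hM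
  have hbalance₀ := reducedAttraction_mul_dist_add_eq_zero (i := 0) (j := 1)
    (by decide) hcc.1 hcirc.1 hp02 hp13 h34 (hm 3) (hμ 0)
  have hbalance₂ := reducedAttraction_mul_dist_add_eq_zero (i := 2) (j := 3)
    (by decide) hcc.1 hcirc.1 hp02.symm hp13.symm h12 (hm 1) (hμ 2)
  have hbalance₃ := reducedAttraction_mul_dist_add_eq_zero (i := 3) (j := 2)
    (by decide) hcc.1 hcirc.1 hp13.symm hp02.symm h12.symm (hm 0) (hμ 3)
  simp only [dist_comm (q 3), dist_comm (q 2) (q 0), dist_comm (q 2) (q 1)]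
    at hbalance₂ hbalance₃
  have h02 := hdist 0 2 (by decide)
  have h13 := hdist 1 3 (by decide)
  have h03 := hdist 0 3 (by decide)
  have h12' := hdist 1 2 (by decide)
  have hdiag : dist (q 0) (q 2) = dist (q 1) (q 3) :=
    eq_of_reducedAttraction_mul_add_eq_zero h02 h13 h03 h12' hbalance₀ hbalance₃
  have hleg : dist (q 0) (q 3) = dist (q 1) (q 2) :=
    eq_of_reducedAttraction_mul_add_eq_zero h03 h12' h02 h13 ((add_comm _ _).trans hbalance₀)
      ((add_comm _ _).trans hbalance₂)
  exact ⟨hstd, parallel_of_sbtw_of_dist_eq hp02 hp13 hleg hdiag, hleg, hdiag⟩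

theorem mainTheorem3 (m : Fin 4 → ℝ) (q : PlanarConfig)
    (hm : ∀ i, 0 < m i)
    (hcc : IsCentralConfiguration m q)
    (hshape : IsConcaveConfiguration q ∨ IsStandardConvexConfiguration q)
    (hcirc : EuclideanGeometry.Concyclic (Set.range q))
    (h12 : m 0 = m 1) (h34 : m 2 = m 3) :
    IsIsoscelesTrapezoid q :=
  mainTheorem3_general m q (fun i => (hm i).ne')
    (Finset.sum_pos (fun i _ => hm i) Finset.univ_nonempty).ne' hcc hshape hcirc h12 h34
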